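/- An effect algebra is a set $E$ with elements $0,1$ and a partial operation $\oplus$ such that: (E1) if $a\oplus b$ is defined, so is $b\oplus a$, and they are equal; (E2) if $b\oplus c$ and $a\oplus(b\oplus c)$ are defined, so are $a\oplus b$ and $(a\oplus b)\oplus c$, and $a\oplus(b\oplus c)=(a\oplus b)\oplus c$; (E3) for each $a$ there is a unique $a'$ with $a\oplus a'=1$; (E4) if $a\oplus 1$ is defined, then $a=0$. Write $a\perp b$ if $a\oplus b$ is defined; $a\le c$ if $a\oplus b=c$ for some $b$, and then $c\ominus a$ denotes this (unique) $b$. Let $L$ be a lattice ordered effect algebra, i.e. an effect algebra for which $\le$ is a lattice order, and let $a\mathbin{\triangle}b=(a\vee b)\ominus(a\wedge b)$. $L$ is an MV-algebra if $(a\vee b)\ominus b=a\ominus(a\wedge b)$ for all $a,b\in L$. A D-uniformity on $L$ is a uniformity making $\vee$, $\wedge$, $\oplus$ and $\ominus$ uniformly continuous (the last two on their domains). Uniformities are ordered by inclusion, so that the weakest is the smallest. For real $k\ge1$, a $k$-submeasure is a function $\eta:L\to[0,+\infty]$ such that $\eta(0)=0$; $\eta(a)\le\eta(b)$ whenever $a\le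 b$; $\eta(a\oplus b)\le k\,\eta(a)+\eta(b)$ whenever $a\perp b$; and $\eta((a\vee b)\ominus b)\le k\,\eta(a)$ for all $a,b\in L$. A submeasure is a $1$-submeasure. Equip $[0,+\infty]$ with the uniformity having as base the sets $\{(x,y)\in[0,+\infty[^2:|x-y|<\varepsilon\}\cup\{(+\infty,+\infty)\}$, $\varepsilon>0$. For a $k$-submeasure $\eta$, let $\mathcal U(\eta)$ denote the weakest D-uniformity on $L$ making $\eta$ uniformly continuous (its existence for the $k$-submeasures below is part of the claim). A modular measure on $L$ with values in a topological Abelian group $G$ is a map $\mu:L\to G$ with $\mu(a)+\mu(b)=\mu(a\vee b)+\mu(a\wedge b)$ for all $a,b$, and $\mu(a\oplus b)=\mu(a)+\mu(b)$ whenever $a\perp b$. A uniformity is generated by $\mu$ if the sets $\{(a,b)\in L\times L:\mu(r)\in W\text{ for all }r\le a\mathbin{\triangle}b\}$, where $W$ runs over the neighbourhoods of $0$ in $G$, form a base of it. **Theorem.** Let $\mathcal U$ be a D-uniformity on $L$. Then: (a) For every real $k>1$ there is a family $(\eta_\lambda)_{\lambda\in\Lambda}$ of $k$-submeasures on $L$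 with $\mathcal U=\sup_{\lambda\in\Lambda}\mathcal U(\eta_\lambda)$. Moreover, if $\mathcal U$ has a countable base, then for every real $k>1$ there is a single $k$-submeasure $\eta$ with $\mathcal U=\mathcal U(\eta)$. (b) If $\mathcal U$ is generated by a modular measure $\mu:L\to G$, where $G$ is a topological Abelian group, then there is a family $(\eta_\lambda)_{\lambda\in\Lambda}$ of submeasures on $L$ with $\mathcal U=\sup_{\lambda\in\Lambda}\mathcal U(\eta_\lambda)$. (c) If $L$ is an MV-algebra, then there is a family $(\eta_\lambda)_{\lambda\in\Lambda}$ of submeasures on $L$ with $\mathcal U=\sup_{\lambda\in\Lambda}\mathcal U(\eta_\lambda)$. -/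

import Mathlib

open Filter Topology Uniformity
open scoped ENNReal NNReal
universe u v

/-- An effect algebra: a set with elements `0`, `1` and a partially defined operation `⊕`.
`oplus a b = some c` means that `a ⊕ b` is defined and equals `c`. -/
class EffectAlgebra (E : Type*) extends Zero E, One E where
  oplus : E → E → Option E
  oplus_comm : ∀ a b c : E, oplus a b = some c → oplus b a = some c
  oplus_assoc : ∀ a b c d e : E, oplus b c = some d → oplus a d = some e →
    ∃ f, oplus a b = some f ∧ oplus f c = some e
  existsUnique_compl : ∀ a : E, ∃! a' : E, oplus a a' = some 1
  eq_zero_of_oplus_one : ∀ a c : E, oplus a 1 = some c → a = 0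

/-- A lattice ordered effect algebra (D-lattice): an effect algebra whose natural order
`a ≤ c ↔ ∃ b, a ⊕ b = c` is a lattice order. -/
class DLattice (L : Type*) extends EffectAlgebra L, Lattice L where
  le_iff_exists_oplus : ∀ a c : L, a ≤ c ↔ ∃ b, oplus a b = some c

namespace DLattice

/-- The cancellation law. -/
theorem oplus_left_cancel {E : Type*} [EffectAlgebra E] {a b c d : E}
    (hb : EffectAlgebra.oplus a b = some d) (hc : EffectAlgebra.oplus a c = some d) : b = c := by
  obtain ⟨d', hd, -⟩ := EffectAlgebra.existsUnique_compl d
  have hd2 := EffectAlgebra.oplus_comm _ _ _ hd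
  obtain ⟨f, hf, hfb⟩ := EffectAlgebra.oplus_assoc _ _ _ _ _ hb hd2
  obtain ⟨g, hg, hgc⟩ := EffectAlgebra.oplus_assoc _ _ _ _ _ hc hd2
  obtain rfl : f = g := Option.some.inj (hf.symm.trans hg)
  exact (EffectAlgebra.existsUnique_compl f).unique hfb hgc

variable {L : Type*} [DLattice L]

/-- `a ⊥ b`: the sum `a ⊕ b` is defined. -/
def Orth (a b : L) : Prop := ∃ c, EffectAlgebra.oplus a b = some c

/-- The sum `a ⊕ b`, with the dummy value `0` where it is not defined. -/
def osum (a b : L) : L := (EffectAlgebra.oplus a b).getD 0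

open Classical in
/-- The difference `c ⊖ a`, i.e. the unique `b` with `a ⊕ b = c`, defined if `a ≤ c`
(with the dummy value `0` where it is not defined). -/
noncomputable def odiff (c a : L) : L :=
  if h : ∃ b, EffectAlgebra.oplus a b = some c then h.choose else 0

theorem odiff_eq_iff {a c : L} (h : a ≤ c) (b : L) :
    odiff c a = b ↔ EffectAlgebra.oplus a b = some c := by
  have h' := (le_iff_exists_oplus a c).1 h
  have hs : EffectAlgebra.oplus a (odiff c a) = some c := by
    rw [odiff, dif_pos h']
    exact h'.choose_spec
  constructor
  · rintro rfl
    exact hs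
  · exact fun hb => oplus_left_cancel hs hb

/-- The symmetric difference `a △ b = (a ∨ b) ⊖ (a ∧ b)`. -/
noncomputable def osymmDiff (a b : L) : L := odiff (a ⊔ b) (a ⊓ b)

variable (L) in
/-- The D-lattice `L` is an MV-algebra. -/
def IsMV : Prop := ∀ a b : L, odiff (a ⊔ b) b = odiff a (a ⊓ b)

/-- A D-uniformity: a uniformity for which `∨`, `∧` and the partial operations `⊕`, `⊖`
(on their domains) are uniformly continuous. -/
structure IsDUniformity (U : UniformSpace L) : Prop where
  uniformContinuous_sup : UniformContinuous fun p : L × L => p.1 ⊔ p.2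
  uniformContinuous_inf : UniformContinuous fun p : L × L => p.1 ⊓ p.2
  uniformContinuousOn_osum :
    UniformContinuousOn (fun p : L × L => osum p.1 p.2) {p | Orth p.1 p.2}
  uniformContinuousOn_odiff :
    UniformContinuousOn (fun p : L × L => odiff p.1 p.2) {p | p.2 ≤ p.1}

/-- The set `{(x, y) ∈ [0, ∞[ × [0, ∞[ : |x - y| < ε} ∪ {(∞, ∞)}`. -/
def extEntourage (ε : ℝ) : Set (ℝ≥0∞ × ℝ≥0∞) :=
  {p | p.1 ≠ ∞ ∧ p.2 ≠ ∞ ∧ |p.1.toReal - p.2.toReal| < ε} ∪ {(∞, ∞)}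

theorem extEntourage_mono {ε δ : ℝ} (h : ε ≤ δ) : extEntourage ε ⊆ extEntourage δ := by
  rintro p (⟨h1, h2, h3⟩ | hp)
  · exact Or.inl ⟨h1, h2, h3.trans_le h⟩
  · exact Or.inr hp

/-- The sets `extEntourage ε`, `ε > 0`, as a filter basis. -/
def extBasis : FilterBasis (ℝ≥0∞ × ℝ≥0∞) where
  sets := {S | ∃ ε : ℝ, 0 < ε ∧ S = extEntourage ε}
  nonempty := ⟨_, 1, one_pos, rfl⟩
  inter_sets := by
    rintro _ _ ⟨ε, hε, rfl⟩ ⟨δ, hδ, rfl⟩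
    exact ⟨_, ⟨min ε δ, lt_min hε hδ, rfl⟩, Set.subset_inter
      (extEntourage_mono (min_le_left _ _)) (extEntourage_mono (min_le_right _ _))⟩

/-- The uniformity on `[0, ∞]` with base the sets `extEntourage ε`, `ε > 0`: the usual one on
`[0, ∞[`, with `∞` a uniformly isolated point. -/
@[reducible]
def extUniformity : UniformSpace ℝ≥0∞ :=
  UniformSpace.ofCore (UniformSpace.Core.mkOfBasis extBasis
    (by
      rintro _ ⟨ε, hε, rfl⟩ x
      by_cases hx : x = ∞
      · subst hx
        exact Or.inr rfl
      · exact Or.inl ⟨hx, hx, by simpa using hε⟩)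
    (by
      rintro _ ⟨ε, hε, rfl⟩
      refine ⟨_, ⟨ε, hε, rfl⟩, ?_⟩
      rintro ⟨x, y⟩ (⟨h1, h2, h3⟩ | hp)
      · exact Or.inl ⟨h2, h1, by simpa [abs_sub_comm] using h3⟩
      · obtain ⟨rfl, rfl⟩ := Prod.mk.inj hp
        exact Or.inr rfl)
    (by
      rintro _ ⟨ε, hε, rfl⟩
      refine ⟨_, ⟨ε / 2, half_pos hε, rfl⟩, ?_⟩
      rintro ⟨x, z⟩ ⟨y, h1, h2⟩
      rcases h1 with ⟨hx, hy, hxy⟩ | h1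
      · rcases h2 with ⟨-, hz, hyz⟩ | h2
        · refine Or.inl ⟨hx, hz, ?_⟩
          have := abs_sub_le x.toReal y.toReal z.toReal
          dsimp only at *
          linarith
        · exact absurd (Prod.mk.inj h2).1 hy
      · obtain ⟨rfl, rfl⟩ := Prod.mk.inj h1
        rcases h2 with ⟨hy, -, -⟩ | h2
        · exact absurd rfl hy
        · exact Or.inr h2))

/-- A `k`-submeasure (the notion is considered for `k ≥ 1`); a submeasure is a
`1`-submeasure. -/
structure IsKSubmeasure (k : ℝ≥0) (η : L → ℝ≥0∞) : Prop where
  zero : η 0 = 0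
  mono : ∀ a b : L, a ≤ b → η a ≤ η b
  osum_le : ∀ a b : L, Orth a b → η (osum a b) ≤ k * η a + η b
  odiff_le : ∀ a b : L, η (odiff (a ⊔ b) b) ≤ k * η a

/-- `V` is the weakest D-uniformity making `η : L → [0, ∞]` uniformly continuous. In the order
of `UniformSpace L`, `W ≤ V` means that every entourage of `V` is an entourage of `W`, so that
the weakest uniformity is the greatest element. -/
def IsUniformityOf (η : L → ℝ≥0∞) (V : UniformSpace L) : Prop :=
  IsGreatest {W : UniformSpace L | IsDUniformity W ∧ @UniformContinuous _ _ W extUniformity η} V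

/-- `U` is the supremum (for inclusion of entourages) of the uniformities of the functions
`η i`. In the order of `UniformSpace L`, where finer uniformities are smaller, this
supremum is written `⨅`. -/
def IsSupOfUniformitiesOf {ι : Type*} (η : ι → L → ℝ≥0∞) (U : UniformSpace L) : Prop :=
  ∃ V : ι → UniformSpace L, (∀ i, IsUniformityOf (η i) (V i)) ∧ U = ⨅ i, V i

/-- A modular measure with values in an abelian group. -/
structure IsModularMeasure {G : Type*} [AddCommGroup G] (μ : L → G) : Prop where
  modular : ∀ a b : L, μ a + μ b = μ (a ⊔ b) + μ (a ⊓ b)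
  additive : ∀ a b : L, Orth a b → μ (osum a b) = μ a + μ b

/-- `U` is generated by `μ`: the sets `{(a, b) : μ r ∈ W for all r ≤ a △ b}`, `W` a neighbourhood
of `0` in `G`, form a base of `U`. -/
def IsGeneratedBy {G : Type*} [AddCommGroup G] [TopologicalSpace G] (μ : L → G)
    (U : UniformSpace L) : Prop :=
  (𝓤[U]).HasBasis (fun W : Set G => W ∈ 𝓝 (0 : G))
    (fun W => {p : L × L | ∀ r : L, r ≤ osymmDiff p.1 p.2 → μ r ∈ W})

end DLattice

/-!
A D-uniformity is determined by its neighbourhoods of `0`: `(a, b)` is close to the diagonal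
exactly when `a △ b` is close to `0` (`IsDUniformity.solidEntourage_mem`,
`IsDUniformity.exists_of_osymmDiff`). So a `k`-submeasure `η` generates a given D-uniformity once
the sets `{η < ε}` form a base at `0`, and there are two things to prove.

*The uniformity of a `k`-submeasure.* The sets `{(a, b) | η (a △ b) < ε}` form a base of a
D-uniformity. The point is that in a lattice ordered effect algebra the maps `· ∨ c` and `· ∧ c`
send an interval `x ≤ y` to one of length `(d ∨ e) ⊖ e` with `d = y ⊖ x`, so the last axiom of a
`k`-submeasure controls them; this yields a weak triangle inequality
(`IsKSubmeasure.osymmDiff_triangle`), from which the uniform continuity of all operations follows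
(`IsKSubmeasure.isDUniformity_uniformity`). By the first remark it is the weakest D-uniformity
making `η` uniformly continuous (`IsKSubmeasure.isUniformityOf`).

*Construction of `k`-submeasures.* Choose symmetric entourages `V n` with
`V (n + 1) ○ V (n + 1) ○ V (n + 1) ⊆ V n` such that translations, truncated so as to be everywhere
defined, send `V (n + 1)` into `V n`. Giving `V n` the radius `q ^ n` with `1 / 2 ≤ q < 1` and
passing to the infimum over chains produces an equivalent pseudometric `ρ`
(`exists_chainDist`) for which truncated translations have Lipschitz constant `q⁻¹`. This is where
`k > 1` enters: `q` can be chosen with `q⁻¹ ≤ k`. The function `η a = sup {ρ 0 c | c ≤ a}` is then a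
`k`-submeasure (`exists_isKSubmeasure_of_dist`). In an MV-algebra truncated translations do not
increase symmetric differences, the entourages may be chosen invariant under them, and `k = 1` is
reached. For the uniformity generated by a modular measure `μ`, the same chain construction in the
group provides continuous subadditive functions `p`, and the variations
`a ↦ sup {p (μ r) | r ≤ a}` are submeasures by modularity (`IsModularMeasure.isKSubmeasure_iSup`).
-/

namespace DLattice

open EffectAlgebra

/-! ### Arithmetic of lattice ordered effect algebras -/

section Algebra

variable {L : Type*} [DLattice L] {a b c x y z : L}

theorem oplus_assoc_right {f e : L} (h : oplus a b = some f) (h' : oplus f c = some e) :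
    ∃ d, oplus b c = some d ∧ oplus a d = some e := by
  obtain ⟨d, hd, hd'⟩ := oplus_assoc _ _ _ _ _ (oplus_comm _ _ _ h) (oplus_comm _ _ _ h')
  exact ⟨d, oplus_comm _ _ _ hd, oplus_comm _ _ _ hd'⟩

theorem zero_oplus (a : L) : oplus 0 a = some a := by
  obtain ⟨z, hz, -⟩ := existsUnique_compl (1 : L)
  obtain rfl := eq_zero_of_oplus_one z 1 (oplus_comm _ _ _ hz)
  obtain ⟨a', ha, -⟩ := existsUnique_compl a
  obtain ⟨f, hf, hfa⟩ := oplus_assoc _ _ _ _ _ ha (oplus_comm _ _ _ hz)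
  obtain rfl := oplus_left_cancel (oplus_comm _ _ _ hfa) (oplus_comm _ _ _ ha)
  exact hf

theorem oplus_zero (a : L) : oplus a 0 = some a :=
  oplus_comm _ _ _ (zero_oplus a)

theorem le_of_oplus_left (h : oplus a b = some c) : a ≤ c :=
  (le_iff_exists_oplus a c).2 ⟨b, h⟩

theorem le_of_oplus_right (h : oplus a b = some c) : b ≤ c :=
  le_of_oplus_left (oplus_comm _ _ _ h)

theorem nonneg (a : L) : 0 ≤ a :=
  le_of_oplus_left (zero_oplus a)

theorem le_one (a : L) : a ≤ 1 :=
  let ⟨_, h, _⟩ := existsUnique_compl a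
  le_of_oplus_left h

theorem eq_zero_of_le_zero (h : a ≤ 0) : a = 0 :=
  le_antisymm h (nonneg a)

theorem oplus_odiff (h : a ≤ c) : oplus a (odiff c a) = some c :=
  (odiff_eq_iff h _).1 rfl

theorem odiff_eq_of_oplus (h : oplus a b = some c) : odiff c a = b :=
  (odiff_eq_iff (le_of_oplus_left h) b).2 h

theorem odiff_self (a : L) : odiff a a = 0 :=
  odiff_eq_of_oplus (oplus_zero a)

theorem odiff_zero (a : L) : odiff a 0 = a :=
  odiff_eq_of_oplus (zero_oplus a)

theorem odiff_le (h : a ≤ c) : odiff c a ≤ c :=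
  le_of_oplus_right (oplus_odiff h)

theorem oplus_osum (h : Orth a b) : oplus a b = some (osum a b) := by
  obtain ⟨c, hc⟩ := h
  rw [osum, hc, Option.getD_some]

theorem osum_eq_of_oplus (h : oplus a b = some c) : osum a b = c := by
  rw [osum, h, Option.getD_some]

theorem zero_osum (a : L) : osum 0 a = a :=
  osum_eq_of_oplus (zero_oplus a)

theorem osum_zero (a : L) : osum a 0 = a :=
  osum_eq_of_oplus (oplus_zero a)

/-- `(y ⊖ x) ⊕ (z ⊖ y) = z ⊖ x` for `x ≤ y ≤ z`. -/
theorem odiff_oplus_odiff (hxy : x ≤ y) (hyz : y ≤ z) :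
    oplus (odiff y x) (odiff z y) = some (odiff z x) := by
  obtain ⟨d, hd, hxd⟩ := oplus_assoc_right (oplus_odiff hxy) (oplus_odiff hyz)
  rwa [odiff_eq_of_oplus hxd]

theorem odiff_le_odiff_right (hxy : x ≤ y) (hyz : y ≤ z) : odiff y x ≤ odiff z x :=
  le_of_oplus_left (odiff_oplus_odiff hxy hyz)

theorem odiff_le_odiff_left (hxy : x ≤ y) (hyz : y ≤ z) : odiff z y ≤ odiff z x :=
  le_of_oplus_right (odiff_oplus_odiff hxy hyz)

theorem odiff_odiff_odiff_right (hxy : x ≤ y) (hyz : y ≤ z) :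
    odiff (odiff z x) (odiff y x) = odiff z y :=
  odiff_eq_of_oplus (odiff_oplus_odiff hxy hyz)

theorem odiff_odiff_odiff_left (hxy : x ≤ y) (hyz : y ≤ z) :
    odiff (odiff z x) (odiff z y) = odiff y x :=
  odiff_eq_of_oplus (oplus_comm _ _ _ (odiff_oplus_odiff hxy hyz))

theorem odiff_odiff_self (h : x ≤ z) : odiff z (odiff z x) = x :=
  odiff_eq_of_oplus (oplus_comm _ _ _ (oplus_odiff h))

theorem le_of_odiff_le_odiff (hx : b ≤ x) (hy : b ≤ y) (h : odiff x b ≤ odiff y b) : x ≤ y := by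
  obtain ⟨f, hf, hfy⟩ := oplus_assoc _ _ _ _ _ (oplus_odiff h) (oplus_odiff hy)
  obtain rfl : f = x := Option.some.inj (hf.symm.trans (oplus_odiff hx))
  exact le_of_oplus_left hfy

/-- Subtraction of `b` is an order isomorphism of `[b, 1]` onto an initial segment, so it
preserves joins. -/
theorem sup_odiff (hx : b ≤ x) (hy : b ≤ y) : odiff (x ⊔ y) b = odiff x b ⊔ odiff y b := by
  have hle : odiff x b ⊔ odiff y b ≤ odiff (x ⊔ y) b :=
    sup_le (odiff_le_odiff_right hx le_sup_left) (odiff_le_odiff_right hy le_sup_right)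
  refine le_antisymm ?_ hle
  obtain ⟨v, hv, -⟩ := oplus_assoc _ _ _ _ _ (oplus_odiff hle)
    (oplus_odiff (hx.trans (le_sup_left : x ≤ x ⊔ y)))
  have hbv := le_of_oplus_left hv
  have hvb := odiff_eq_of_oplus hv
  rw [← hvb]
  exact odiff_le_odiff_right (hx.trans le_sup_left) <| sup_le
    (le_of_odiff_le_odiff hx hbv (hvb ▸ le_sup_left))
    (le_of_odiff_le_odiff hy hbv (hvb ▸ le_sup_right))

/-- The orthosupplement `a' = 1 ⊖ a`. -/
noncomputable def ocompl (a : L) : L := odiff 1 a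

theorem ocompl_ocompl (a : L) : ocompl (ocompl a) = a :=
  odiff_odiff_self (le_one a)

theorem ocompl_anti (h : x ≤ y) : ocompl y ≤ ocompl x :=
  odiff_le_odiff_left h (le_one y)

theorem odiff_ocompl (h : x ≤ y) : odiff (ocompl x) (ocompl y) = odiff y x :=
  odiff_odiff_odiff_left h (le_one y)

theorem ocompl_inf (x y : L) : ocompl (x ⊓ y) = ocompl x ⊔ ocompl y := by
  refine le_antisymm ?_ (sup_le (ocompl_anti inf_le_left) (ocompl_anti inf_le_right))
  rw [← ocompl_ocompl (ocompl x ⊔ ocompl y)]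
  refine ocompl_anti (le_inf ?_ ?_)
  · rw [← ocompl_ocompl x]
    exact ocompl_anti (by rw [ocompl_ocompl]; exact le_sup_left)
  · rw [← ocompl_ocompl y]
    exact ocompl_anti (by rw [ocompl_ocompl]; exact le_sup_right)

theorem ocompl_sup (x y : L) : ocompl (x ⊔ y) = ocompl x ⊓ ocompl y := by
  rw [← ocompl_ocompl (ocompl x ⊓ ocompl y), ocompl_inf, ocompl_ocompl, ocompl_ocompl]

theorem orth_iff : Orth a b ↔ a ≤ ocompl b := by
  constructor
  · rintro ⟨c, hc⟩
    obtain ⟨d, hd, hbd⟩ := oplus_assoc_right (oplus_comm _ _ _ hc) (oplus_odiff (le_one c))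
    rw [ocompl, odiff_eq_of_oplus hbd]
    exact le_of_oplus_left hd
  · intro h
    obtain ⟨f, hf, -⟩ := oplus_assoc _ _ _ _ _ (oplus_odiff h) (oplus_odiff (le_one b))
    exact ⟨f, oplus_comm _ _ _ hf⟩

theorem Orth.symm (h : Orth a b) : Orth b a :=
  let ⟨c, hc⟩ := h
  ⟨c, oplus_comm _ _ _ hc⟩

theorem osum_comm (h : Orth a b) : osum a b = osum b a :=
  (osum_eq_of_oplus (oplus_comm _ _ _ (oplus_osum h))).symm

theorem Orth.mono {a₁ b₁ : L} (h : Orth a b) (ha : a₁ ≤ a) (hb : b₁ ≤ b) : Orth a₁ b₁ :=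
  orth_iff.2 (ha.trans ((orth_iff.1 h).trans (ocompl_anti hb)))

theorem orth_odiff (h : a ≤ c) : Orth a (odiff c a) :=
  ⟨c, oplus_odiff h⟩

theorem osum_odiff (h : a ≤ c) : osum a (odiff c a) = c :=
  osum_eq_of_oplus (oplus_odiff h)

/-- Subtraction is addition, conjugated by the orthosupplement: `a ⊖ b = (a' ⊕ b)'`. -/
theorem osum_ocompl (h : b ≤ a) : osum (ocompl a) b = ocompl (odiff a b) := by
  apply osum_eq_of_oplus
  obtain ⟨d, hd, hbd⟩ := oplus_assoc_right (oplus_comm _ _ _ (oplus_odiff h))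
    (oplus_odiff (le_one a))
  rw [ocompl, ocompl, odiff_eq_of_oplus hbd]
  exact oplus_comm _ _ _ hd

/-- `(y ⊕ b) ⊖ (x ⊕ b) = y ⊖ x` for `x ≤ y`. -/
theorem osum_oplus_odiff (hxy : x ≤ y) (h : Orth y b) :
    oplus (osum x b) (odiff y x) = some (osum y b) := by
  obtain ⟨f, hf, hfb⟩ := oplus_assoc _ _ _ _ _ (oplus_odiff hxy)
    (oplus_comm _ _ _ (oplus_osum h))
  rwa [osum_comm (h.mono hxy le_rfl), osum_eq_of_oplus hf]

theorem osum_mono_left (hxy : x ≤ y) (h : Orth y b) : osum x b ≤ osum y b :=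
  le_of_oplus_left (osum_oplus_odiff hxy h)

theorem osum_odiff_osum (hxy : x ≤ y) (h : Orth y b) :
    odiff (osum y b) (osum x b) = odiff y x :=
  odiff_eq_of_oplus (osum_oplus_odiff hxy h)

theorem odiff_osum_right (h : Orth a b) : odiff (osum a b) b = a :=
  odiff_eq_of_oplus (oplus_comm _ _ _ (oplus_osum h))

/-- Joining with `c` sends the interval from `x` to `y` to one whose length arises from `y ⊖ x`
by one application of `d ↦ (d ∨ e) ⊖ e`. -/
theorem exists_odiff_sup (hxy : x ≤ y) (c : L) :
    ∃ e, odiff (y ⊔ c) (x ⊔ c) = odiff (odiff y x ⊔ e) e := by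
  refine ⟨odiff (x ⊔ c) x, ?_⟩
  rw [← sup_odiff hxy le_sup_left, ← sup_assoc, sup_eq_left.2 hxy,
    odiff_odiff_odiff_right le_sup_left (sup_le_sup_right hxy c)]

theorem exists_odiff_inf (hxy : x ≤ y) (c : L) :
    ∃ e, odiff (y ⊓ c) (x ⊓ c) = odiff (odiff y x ⊔ e) e := by
  obtain ⟨e, he⟩ := exists_odiff_sup (ocompl_anti hxy) (ocompl c)
  refine ⟨e, ?_⟩
  rw [← odiff_ocompl (inf_le_inf_right c hxy), ocompl_inf, ocompl_inf, he, odiff_ocompl hxy]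

theorem osymmDiff_comm (a b : L) : osymmDiff a b = osymmDiff b a := by
  rw [osymmDiff, osymmDiff, sup_comm, inf_comm]

theorem osymmDiff_self (a : L) : osymmDiff a a = 0 := by
  rw [osymmDiff, sup_idem, inf_idem, odiff_self]

theorem osymmDiff_of_le (h : a ≤ b) : osymmDiff a b = odiff b a := by
  rw [osymmDiff, sup_eq_right.2 h, inf_eq_left.2 h]

theorem zero_osymmDiff (a : L) : osymmDiff 0 a = a := by
  rw [osymmDiff_of_le (nonneg a), odiff_zero]

theorem osymmDiff_ocompl (a b : L) : osymmDiff (ocompl a) (ocompl b) = osymmDiff a b := by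
  rw [osymmDiff, ← ocompl_inf, ← ocompl_sup, odiff_ocompl inf_le_sup, osymmDiff]

theorem osymmDiff_le_odiff (hxa : x ≤ a) (hxb : x ≤ b) (hay : a ≤ y) (hby : b ≤ y) :
    osymmDiff a b ≤ odiff y x :=
  (odiff_le_odiff_right inf_le_sup (sup_le hay hby)).trans
    (odiff_le_odiff_left (le_inf hxa hxb) (inf_le_sup.trans (sup_le hay hby)))

theorem osymmDiff_sup_le (a b c : L) :
    osymmDiff (a ⊔ c) (b ⊔ c) ≤ odiff (a ⊔ b ⊔ c) (a ⊓ b ⊔ c) :=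
  osymmDiff_le_odiff (sup_le_sup_right inf_le_left c) (sup_le_sup_right inf_le_right c)
    (sup_le_sup_right le_sup_left c) (sup_le_sup_right le_sup_right c)

theorem osymmDiff_inf_le (a b c : L) :
    osymmDiff (a ⊓ c) (b ⊓ c) ≤ odiff ((a ⊔ b) ⊓ c) (a ⊓ b ⊓ c) :=
  osymmDiff_le_odiff (inf_le_inf_right c inf_le_left) (inf_le_inf_right c inf_le_right)
    (inf_le_inf_right c le_sup_left) (inf_le_inf_right c le_sup_right)

theorem osymmDiff_odiff_le (ha : c ≤ a) (hb : c ≤ b) :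
    osymmDiff (odiff a c) (odiff b c) ≤ osymmDiff a b := by
  have hc : c ≤ a ⊓ b := le_inf ha hb
  change _ ≤ odiff (a ⊔ b) (a ⊓ b)
  rw [← odiff_odiff_odiff_right hc inf_le_sup]
  exact osymmDiff_le_odiff (odiff_le_odiff_right hc inf_le_left)
    (odiff_le_odiff_right hc inf_le_right) (odiff_le_odiff_right ha le_sup_left)
    (odiff_le_odiff_right hb le_sup_right)

theorem osymmDiff_osum_le (ha : Orth a c) (hb : Orth b c) :
    osymmDiff (osum a c) (osum b c) ≤ osymmDiff a b := by
  have hc : Orth (a ⊔ b) c := orth_iff.2 (sup_le (orth_iff.1 ha) (orth_iff.1 hb))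
  change _ ≤ odiff (a ⊔ b) (a ⊓ b)
  rw [← osum_odiff_osum inf_le_sup hc]
  exact osymmDiff_le_odiff (osum_mono_left inf_le_left ha) (osum_mono_left inf_le_right hb)
    (osum_mono_left le_sup_left hc) (osum_mono_left le_sup_right hc)

namespace IsMV

theorem odiff_sup_le (h : IsMV L) (a b : L) : odiff (a ⊔ b) b ≤ a :=
  (h a b).trans_le (DLattice.odiff_le inf_le_left)

theorem osymmDiff_sup_le (h : IsMV L) (a b c : L) :
    osymmDiff (a ⊔ c) (b ⊔ c) ≤ osymmDiff a b := by
  obtain ⟨e, he⟩ := exists_odiff_sup (inf_le_sup : a ⊓ b ≤ a ⊔ b) c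
  exact (DLattice.osymmDiff_sup_le a b c).trans (he.trans_le (h.odiff_sup_le _ e))

theorem osymmDiff_inf_le (h : IsMV L) (a b c : L) :
    osymmDiff (a ⊓ c) (b ⊓ c) ≤ osymmDiff a b := by
  obtain ⟨e, he⟩ := exists_odiff_inf (inf_le_sup : a ⊓ b ≤ a ⊔ b) c
  exact (DLattice.osymmDiff_inf_le a b c).trans (he.trans_le (h.odiff_sup_le _ e))

end IsMV

end Algebra

/-! ### Chain distances -/

section ChainDistance

/-- Recursive choice of a sequence, with a relation between consecutive terms. -/
theorem exists_seq_of_step {α : Type*} {P : α → Prop} {R : ℕ → α → α → Prop}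
    (h₀ : ∃ s, P s) (step : ∀ n s, P s → ∃ t, P t ∧ R n s t) :
    ∃ V : ℕ → α, ∀ n, P (V n) ∧ R n (V n) (V (n + 1)) := by
  choose! f hf using step
  obtain ⟨s, hs⟩ := h₀
  let V : ℕ → α := fun n => Nat.rec s (fun n t => f n t) n
  have hV : ∀ n, P (V n) := by
    intro n
    induction n with
    | zero => exact hs
    | succ n ih => exact (hf n _ ih).1
  exact ⟨V, fun n => ⟨hV n, (hf n _ (hV n)).2⟩⟩

variable {X : Type*}

theorem ofPreNNDist_dist_map_le {d : X → X → ℝ≥0} (hs : ∀ x, d x x = 0)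
    (hc : ∀ x y, d x y = d y x) {f : X → X} {k : ℝ≥0} (hf : ∀ x y, d (f x) (f y) ≤ k * d x y)
    (x y : X) :
    (PseudoMetricSpace.ofPreNNDist d hs hc).dist (f x) (f y) ≤
      k * (PseudoMetricSpace.ofPreNNDist d hs hc).dist x y := by
  have key : ∀ (l : List X) (x : X), (List.zipWith d (f x :: l.map f) (l.map f ++ [f y])).sum ≤
      k * (List.zipWith d (x :: l) (l ++ [y])).sum := by
    intro l
    induction l with
    | nil => intro x; simpa using hf x y
    | cons a l ih =>
      intro x
      simp only [List.map_cons, List.cons_append, List.zipWith_cons_cons, List.sum_cons, mul_add]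
        at ih ⊢
      exact add_le_add (hf x a) (ih a)
  change ((⨅ l : List X, (List.zipWith d (f x :: l) (l ++ [f y])).sum : ℝ≥0) : ℝ) ≤
    k * ((⨅ l : List X, (List.zipWith d (x :: l) (l ++ [y])).sum : ℝ≥0) : ℝ)
  rw [← NNReal.coe_mul, NNReal.mul_iInf, NNReal.coe_le_coe]
  exact le_ciInf fun l => (ciInf_le (OrderBot.bddBelow _) (l.map f)).trans (key l x)

open Classical in
/-- The function equal to `q ^ n` at `(x, y)` if `n` is the first index with `(x, y) ∉ V n`, and
to `0` if there is no such index. -/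
noncomputable def levelFun (q : ℝ≥0) (V : ℕ → Set (X × X)) (x y : X) : ℝ≥0 :=
  if h : ∃ n, (x, y) ∉ V n then q ^ Nat.find h else 0

theorem levelFun_eq_zero_or (q : ℝ≥0) (V : ℕ → Set (X × X)) (x y : X) :
    levelFun q V x y = 0 ∨ ∃ n, levelFun q V x y = q ^ n := by
  classical
  unfold levelFun
  split_ifs with h
  · exact Or.inr ⟨_, rfl⟩
  · exact Or.inl rfl

variable {q : ℝ≥0} {V : ℕ → Set (X × X)}

theorem levelFun_lt_iff (h0 : 0 < q) (h1 : q < 1) (hV : Antitone V) {x y : X} {n : ℕ} :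
    levelFun q V x y < q ^ n ↔ (x, y) ∈ V n := by
  classical
  unfold levelFun
  split_ifs with h
  · rw [pow_lt_pow_iff_right_of_lt_one₀ h0 h1]
    constructor
    · intro hn
      by_contra hxy
      exact absurd (Nat.find_min' h hxy) (not_le.2 hn)
    · intro hxy
      by_contra hn
      exact Nat.find_spec h (hV (not_lt.1 hn) hxy)
  · push Not at h
    exact iff_of_true (pow_pos h0 n) (h n)

theorem levelFun_self (hr : ∀ n x, (x, x) ∈ V n) (x : X) : levelFun q V x x = 0 := by
  unfold levelFun
  rw [dif_neg]
  push Not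
  exact fun n => hr n x

theorem levelFun_comm (hs : ∀ n x y, (x, y) ∈ V n → (y, x) ∈ V n) (x y : X) :
    levelFun q V x y = levelFun q V y x := by
  classical
  have h : ∀ n, (x, y) ∉ V n ↔ (y, x) ∉ V n := fun n => not_congr ⟨hs n x y, hs n y x⟩
  unfold levelFun
  simp only [h]

/-- **Chain distance.** A decreasing sequence of symmetric relations with
`V (n + 1) ○ V (n + 1) ○ V (n + 1) ⊆ V n` is equivalent to a pseudometric `ρ` in which `V n` has
radius about `q ^ n`. The ratio `q` of the radii may be taken close to `1`; a map losing one index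
of the sequence then has Lipschitz constant `q⁻¹` only, and a map losing none is nonexpansive. -/
theorem exists_chainDist (hq : 2⁻¹ ≤ q) (h1 : q < 1) (hr : ∀ n x, (x, x) ∈ V n)
    (hs : ∀ n x y, (x, y) ∈ V n → (y, x) ∈ V n)
    (ht : ∀ n x y z w, (x, y) ∈ V (n + 1) → (y, z) ∈ V (n + 1) → (z, w) ∈ V (n + 1) →
      (x, w) ∈ V n) :
    ∃ ρ : X → X → ℝ≥0, (∀ x, ρ x x = 0) ∧ (∀ x y z, ρ x z ≤ ρ x y + ρ y z) ∧
      (∀ n x y, (x, y) ∈ V n → ρ x y ≤ q ^ n) ∧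
      (∀ n x y, 2 * ρ x y < q ^ n → (x, y) ∈ V n) ∧
      (∀ f : X → X, (∀ n x y, (x, y) ∈ V (n + 1) → (f x, f y) ∈ V n) →
        ∀ x y, ρ (f x) (f y) ≤ q⁻¹ * ρ x y) ∧
      (∀ f : X → X, (∀ n x y, (x, y) ∈ V n → (f x, f y) ∈ V n) →
        ∀ x y, ρ (f x) (f y) ≤ ρ x y) := by
  have h0 : 0 < q := lt_of_lt_of_le (by positivity) hq
  have hV : Antitone V := antitone_nat_of_succ_le fun n p hp =>
    ht n p.1 p.1 p.1 p.2 (hr _ _) (hr _ _) hp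
  have hlt : ∀ {x y n}, levelFun q V x y < q ^ n ↔ (x, y) ∈ V n := levelFun_lt_iff h0 h1 hV
  have hself := levelFun_self (q := q) hr
  have hcomm := levelFun_comm (q := q) hs
  have frink : ∀ x₁ x₂ x₃ x₄, levelFun q V x₁ x₄ ≤
      2 * max (levelFun q V x₁ x₂) (max (levelFun q V x₂ x₃) (levelFun q V x₃ x₄)) := by
    intro x₁ x₂ x₃ x₄
    rcases levelFun_eq_zero_or q V x₁ x₄ with h | ⟨n, h⟩
    · rw [h]; exact zero_le
    by_contra! hlt'
    have hq2 : (1 : ℝ≥0) ≤ 2 * q := by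
      calc (1 : ℝ≥0) = 2 * 2⁻¹ := (mul_inv_cancel₀ two_ne_zero).symm
        _ ≤ 2 * q := by gcongr
    have hm : max (levelFun q V x₁ x₂) (max (levelFun q V x₂ x₃) (levelFun q V x₃ x₄)) <
        q ^ (n + 1) := by
      refine lt_of_mul_lt_mul_left (hlt'.trans_le ?_) (zero_le (a := (2 : ℝ≥0)))
      rw [h, pow_succ', ← mul_assoc]
      exact le_mul_of_one_le_left zero_le hq2
    simp only [max_lt_iff, hlt] at hm
    exact absurd (hlt.2 (ht n _ _ _ _ hm.1 hm.2.1 hm.2.2)) h.not_lt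
  let I := PseudoMetricSpace.ofPreNNDist (levelFun q V) hself hcomm
  have hle : ∀ x y, nndist x y ≤ levelFun q V x y := fun x y =>
    PseudoMetricSpace.dist_ofPreNNDist_le (levelFun q V) hself hcomm x y
  have hge : ∀ x y, levelFun q V x y ≤ 2 * nndist x y := fun x y => by
    have := PseudoMetricSpace.le_two_mul_dist_ofPreNNDist (levelFun q V) hself hcomm frink x y
    exact_mod_cast this
  have hmap : ∀ (f : X → X) (k : ℝ≥0),
      (∀ x y, levelFun q V (f x) (f y) ≤ k * levelFun q V x y) →
      ∀ x y, nndist (f x) (f y) ≤ k * nndist x y := fun f k hf x y => by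
    have := ofPreNNDist_dist_map_le hself hcomm hf x y
    exact_mod_cast this
  refine ⟨fun x y => nndist x y, fun x => nndist_self x, fun x y z => nndist_triangle x y z,
    fun n x y hxy => (hle x y).trans (hlt.2 hxy).le, fun n x y hxy => hlt.1 ((hge x y).trans_lt hxy),
    fun f hf => hmap f _ fun x y => ?_, fun f hf x y => ?_⟩
  · rcases levelFun_eq_zero_or q V (f x) (f y) with h | ⟨n, h⟩
    · rw [h]; exact zero_le
    by_contra! hlt'
    rw [h, inv_mul_lt_iff₀ h0, ← pow_succ', hlt] at hlt'
    exact absurd (hlt.2 (hf n x y hlt')) h.not_lt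
  · refine (hmap f 1 (fun x y => ?_) x y).trans_eq (one_mul _)
    rw [one_mul]
    rcases levelFun_eq_zero_or q V (f x) (f y) with h | ⟨n, h⟩
    · rw [h]; exact zero_le
    by_contra! hlt'
    rw [h, hlt] at hlt'
    exact absurd (hlt.2 (hf n x y hlt')) h.not_lt

end ChainDistance

/-! ### The uniformity of a submeasure -/

section SubmeasureUniformity

variable {L : Type*} [DLattice L] {k : ℝ≥0} {η : L → ℝ≥0∞}

namespace IsKSubmeasure

theorem odiff_sup_sup_le (h : IsKSubmeasure k η) {x y : L} (hxy : x ≤ y) (c : L) :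
    η (odiff (y ⊔ c) (x ⊔ c)) ≤ k * η (odiff y x) := by
  obtain ⟨e, he⟩ := exists_odiff_sup hxy c
  exact he ▸ h.odiff_le _ e

theorem odiff_inf_inf_le (h : IsKSubmeasure k η) {x y : L} (hxy : x ≤ y) (c : L) :
    η (odiff (y ⊓ c) (x ⊓ c)) ≤ k * η (odiff y x) := by
  obtain ⟨e, he⟩ := exists_odiff_inf hxy c
  exact he ▸ h.odiff_le _ e

theorem odiff_trans_le (h : IsKSubmeasure k η) {x y z : L} (hxy : x ≤ y) (hyz : y ≤ z) :
    η (odiff z x) ≤ k * η (odiff y x) + η (odiff z y) := by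
  have H := odiff_oplus_odiff hxy hyz
  rw [← osum_eq_of_oplus H]
  exact h.osum_le _ _ ⟨_, H⟩

theorem osymmDiff_sup_le (h : IsKSubmeasure k η) (a b c : L) :
    η (osymmDiff (a ⊔ c) (b ⊔ c)) ≤ k * η (osymmDiff a b) :=
  (h.mono _ _ (DLattice.osymmDiff_sup_le a b c)).trans (h.odiff_sup_sup_le inf_le_sup c)

theorem osymmDiff_inf_le (h : IsKSubmeasure k η) (a b c : L) :
    η (osymmDiff (a ⊓ c) (b ⊓ c)) ≤ k * η (osymmDiff a b) :=
  (h.mono _ _ (DLattice.osymmDiff_inf_le a b c)).trans (h.odiff_inf_inf_le inf_le_sup c)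

/-- A weak triangle inequality for `(a, b) ↦ η (a △ b)`. It comes from the chain
`a ∧ b ∧ c ≤ a ∧ b ≤ a ∨ b ≤ a ∨ b ∨ c`, whose outer steps are obtained from `b ∧ c ≤ b` and
`b ≤ b ∨ c` by meeting with `a` and joining with `a`. -/
theorem osymmDiff_triangle (h : IsKSubmeasure k η) (a b c : L) :
    η (osymmDiff a c) ≤
      k * (k * (k * η (osymmDiff b c)) + η (osymmDiff a b)) + k * η (osymmDiff b c) := by
  have h1 : η (odiff (b ⊓ a) (b ⊓ c ⊓ a)) ≤ k * η (osymmDiff b c) :=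
    (h.odiff_inf_inf_le inf_le_left a).trans <| mul_le_mul_right
      (h.mono _ _ (odiff_le_odiff_right inf_le_left le_sup_left)) _
  have h2 : η (odiff (b ⊔ c ⊔ a) (b ⊔ a)) ≤ k * η (osymmDiff b c) :=
    (h.odiff_sup_sup_le le_sup_left a).trans <| mul_le_mul_right
      (h.mono _ _ (odiff_le_odiff_left inf_le_left le_sup_left)) _
  have l1 : b ⊓ c ⊓ a ≤ b ⊓ a := inf_le_inf_right a inf_le_left
  have l2 : b ⊓ a ≤ b ⊔ a := inf_le_sup
  have l3 : b ⊔ a ≤ b ⊔ c ⊔ a := sup_le_sup_right le_sup_left a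
  have h3 : η (odiff (b ⊔ a) (b ⊓ a)) = η (osymmDiff a b) := by rw [osymmDiff_comm a b, osymmDiff]
  have hm : η (osymmDiff a c) ≤ η (odiff (b ⊔ c ⊔ a) (b ⊓ c ⊓ a)) :=
    h.mono _ _ (osymmDiff_le_odiff inf_le_right (inf_le_left.trans inf_le_right) le_sup_right
      (le_sup_right.trans le_sup_left))
  refine hm.trans ((h.odiff_trans_le (l1.trans l2) l3).trans ?_)
  refine (add_le_add (mul_le_mul_right (h.odiff_trans_le l1 l2) _) h2).trans ?_
  rw [h3]
  gcongr

/-- Both `a ⊕ b` and `c ⊕ d` are compared with `(a ∧ c) ⊕ (b ∧ d)`, which is always defined. -/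
theorem osymmDiff_osum_inf_le (h : IsKSubmeasure k η) {a b : L} (hab : Orth a b) (c d : L) :
    η (osymmDiff (osum a b) (osum (a ⊓ c) (b ⊓ d))) ≤
      k * η (osymmDiff b d) + η (osymmDiff a c) := by
  have h1 : osum (a ⊓ c) (b ⊓ d) ≤ osum (a ⊓ c) b := by
    rw [osum_comm (hab.mono inf_le_left inf_le_left), osum_comm (hab.mono inf_le_left le_rfl)]
    exact osum_mono_left inf_le_left (hab.mono inf_le_left le_rfl).symm
  have h2 : osum (a ⊓ c) b ≤ osum a b := osum_mono_left inf_le_left hab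
  rw [osymmDiff_comm, osymmDiff_of_le (h1.trans h2)]
  refine (h.odiff_trans_le h1 h2).trans (add_le_add (mul_le_mul_right ?_ _) ?_)
  · rw [osum_comm (hab.mono inf_le_left inf_le_left), osum_comm (hab.mono inf_le_left le_rfl),
      osum_odiff_osum inf_le_left (hab.mono inf_le_left le_rfl).symm]
    exact h.mono _ _ (odiff_le_odiff_right inf_le_left le_sup_left)
  · rw [osum_odiff_osum inf_le_left hab]
    exact h.mono _ _ (odiff_le_odiff_right inf_le_left le_sup_left)

theorem le_osymmDiff_add (h : IsKSubmeasure k η) (a b : L) : η a ≤ k * η (osymmDiff a b) + η b := by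
  have hle : a ⊓ b ≤ a ⊔ b := inf_le_sup
  have H := (orth_odiff hle).symm
  calc η a ≤ η (osum (odiff (a ⊔ b) (a ⊓ b)) (a ⊓ b)) := by
        rw [osum_comm H, osum_odiff hle]; exact h.mono _ _ le_sup_left
    _ ≤ k * η (osymmDiff a b) + η (a ⊓ b) := h.osum_le _ _ H
    _ ≤ _ := by gcongr; exact h.mono _ _ inf_le_right

theorem osymmDiff_osum_osum_le (h : IsKSubmeasure k η) {a b c d : L} (hab : Orth a b)
    (hcd : Orth c d) {B : ℝ≥0∞} (hB : k * η (osymmDiff b d) + η (osymmDiff a c) ≤ B) :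
    η (osymmDiff (osum a b) (osum c d)) ≤ k * (k * (k * B) + B) + k * B := by
  have h1 := (h.osymmDiff_osum_inf_le hab c d).trans hB
  have h2 : η (osymmDiff (osum (a ⊓ c) (b ⊓ d)) (osum c d)) ≤ B := by
    have := h.osymmDiff_osum_inf_le hcd a b
    rw [osymmDiff_comm d b, osymmDiff_comm c a] at this
    rw [osymmDiff_comm, inf_comm a, inf_comm b]
    exact this.trans hB
  refine (h.osymmDiff_triangle _ (osum (a ⊓ c) (b ⊓ d)) _).trans ?_
  gcongr

end IsKSubmeasure

theorem tendsto_const_mul_zero {α : Type*} {l : Filter α} {f : α → ℝ≥0∞} (k : ℝ≥0)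
    (hf : Tendsto f l (𝓝 0)) : Tendsto (fun x => k * f x) l (𝓝 0) := by
  simpa using ENNReal.Tendsto.const_mul hf (Or.inr (ENNReal.coe_ne_top (r := k)))

theorem tendsto_triangle_bound {α : Type*} {l : Filter α} {f g : α → ℝ≥0∞} (k : ℝ≥0)
    (hf : Tendsto f l (𝓝 0)) (hg : Tendsto g l (𝓝 0)) :
    Tendsto (fun x => k * (k * (k * g x) + f x) + k * g x) l (𝓝 0) := by
  have h1 : Tendsto (fun x => k * (k * g x) + f x) l (𝓝 0) := by
    simpa using (tendsto_const_mul_zero k (tendsto_const_mul_zero k hg)).add hf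
  simpa using (tendsto_const_mul_zero k h1).add (tendsto_const_mul_zero k hg)

theorem tendsto_zero_of_le {α : Type*} {l : Filter α} {f g : α → ℝ≥0∞}
    (hg : Tendsto g l (𝓝 0)) (h : ∀ᶠ x in l, f x ≤ g x) : Tendsto f l (𝓝 0) :=
  tendsto_of_tendsto_of_tendsto_of_le_of_le' tendsto_const_nhds hg
    (Eventually.of_forall fun _ => zero_le) h

namespace IsKSubmeasure

/-- The uniformity with base `{(a, b) : η (a △ b) < ε}`, `ε > 0`. -/
@[reducible]
noncomputable def uniformity (h : IsKSubmeasure k η) : UniformSpace L :=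
  UniformSpace.ofCore
    { uniformity := comap (fun p : L × L => η (osymmDiff p.1 p.2)) (𝓝 0)
      refl := by
        rw [← tendsto_iff_comap]
        refine tendsto_const_nhds.congr' (eventually_principal.2 ?_)
        rintro ⟨a, b⟩ (rfl : a = b)
        change 0 = η (osymmDiff a a)
        rw [osymmDiff_self, h.zero]
      symm := by
        rw [tendsto_comap_iff]
        refine tendsto_comap.congr fun p => ?_
        rw [osymmDiff_comm]; rfl
      comp := by
        rintro s ⟨t, ht, hts⟩
        obtain ⟨ε, hε, hεt⟩ := ENNReal.nhds_zero_basis.mem_iff.1 ht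
        have hT := tendsto_triangle_bound (l := 𝓝 (0 : ℝ≥0∞) ×ˢ 𝓝 0) k tendsto_fst tendsto_snd
        obtain ⟨u, hu, hu'⟩ := mem_prod_same_iff.1 (hT (Iio_mem_nhds hε))
        refine mem_of_superset (mem_lift' (preimage_mem_comap hu)) ?_
        rintro ⟨a, c⟩ ⟨b, hab, hbc⟩
        exact hts (hεt ((h.osymmDiff_triangle a b c).trans_lt
          (hu' (Set.mk_mem_prod hab hbc)))) }

theorem uniformity_eq (h : IsKSubmeasure k η) :
    𝓤[h.uniformity] = comap (fun p : L × L => η (osymmDiff p.1 p.2)) (𝓝 0) :=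
  rfl

theorem le_uniformity_iff (h : IsKSubmeasure k η) {U : UniformSpace L} :
    U ≤ h.uniformity ↔ Tendsto (fun p : L × L => η (osymmDiff p.1 p.2)) 𝓤[U] (𝓝 0) :=
  tendsto_iff_comap.symm

theorem isDUniformity_uniformity (h : IsKSubmeasure k η) : IsDUniformity h.uniformity := by
  let _ := h.uniformity
  have hη : Tendsto (fun p : L × L => η (osymmDiff p.1 p.2)) (𝓤 L) (𝓝 0) := tendsto_comap
  have H1 : Tendsto (fun p : (L × L) × (L × L) => η (osymmDiff p.1.1 p.2.1)) (𝓤 (L × L)) (𝓝 0) :=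
    hη.comp (uniformContinuous_fst (α := L) (β := L))
  have H2 : Tendsto (fun p : (L × L) × (L × L) => η (osymmDiff p.1.2 p.2.2)) (𝓤 (L × L)) (𝓝 0) :=
    hη.comp (uniformContinuous_snd (α := L) (β := L))
  have hB1 : Tendsto (fun p : (L × L) × (L × L) => k * η (osymmDiff p.1.2 p.2.2) +
      η (osymmDiff p.1.1 p.2.1)) (𝓤 (L × L)) (𝓝 0) := by
    simpa using (tendsto_const_mul_zero k H2).add H1
  have hB := tendsto_triangle_bound k hB1 hB1
  refine ⟨tendsto_comap_iff.2 ?_, tendsto_comap_iff.2 ?_, tendsto_comap_iff.2 ?_,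
    tendsto_comap_iff.2 ?_⟩
  · refine tendsto_zero_of_le (tendsto_triangle_bound k (tendsto_const_mul_zero k H1)
      (tendsto_const_mul_zero k H2)) (Eventually.of_forall ?_)
    rintro ⟨⟨a, b⟩, ⟨c, d⟩⟩
    refine (h.osymmDiff_triangle _ (c ⊔ b) _).trans ?_
    have h1 := h.osymmDiff_sup_le a c b
    have h2 := h.osymmDiff_sup_le b d c
    rw [sup_comm b, sup_comm d] at h2
    dsimp only
    gcongr
  · refine tendsto_zero_of_le (tendsto_triangle_bound k (tendsto_const_mul_zero k H1)
      (tendsto_const_mul_zero k H2)) (Eventually.of_forall ?_)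
    rintro ⟨⟨a, b⟩, ⟨c, d⟩⟩
    refine (h.osymmDiff_triangle _ (c ⊓ b) _).trans ?_
    have h1 := h.osymmDiff_inf_le a c b
    have h2 := h.osymmDiff_inf_le b d c
    rw [inf_comm b, inf_comm d] at h2
    dsimp only
    gcongr
  · refine tendsto_zero_of_le (hB.mono_left inf_le_left)
      (eventually_inf_principal.2 (Eventually.of_forall ?_))
    rintro ⟨⟨a, b⟩, ⟨c, d⟩⟩ ⟨hab, hcd⟩
    exact h.osymmDiff_osum_osum_le hab hcd le_rfl
  · refine tendsto_zero_of_le (hB.mono_left inf_le_left)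
      (eventually_inf_principal.2 (Eventually.of_forall ?_))
    rintro ⟨⟨a, b⟩, ⟨c, d⟩⟩ ⟨hab, hcd⟩
    have h1 : Orth (ocompl a) b := orth_iff.2 (ocompl_anti hab)
    have h2 : Orth (ocompl c) d := orth_iff.2 (ocompl_anti hcd)
    change η (osymmDiff (odiff a b) (odiff c d)) ≤ _
    rw [← osymmDiff_ocompl, ← osum_ocompl hab, ← osum_ocompl hcd]
    exact h.osymmDiff_osum_osum_le h1 h2 (by rw [osymmDiff_ocompl])

theorem uniformContinuous_uniformity (h : IsKSubmeasure k η) :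
    @UniformContinuous _ _ h.uniformity extUniformity η := by
  have hle : ∀ {a b : L}, k * η (osymmDiff a b) ≠ ∞ → η b ≠ ∞ →
      η a ≠ ∞ ∧ (η a).toReal ≤ (k * η (osymmDiff a b)).toReal + (η b).toReal := by
    intro a b h1 h2
    have h3 := ENNReal.add_ne_top.2 ⟨h1, h2⟩
    rw [← ENNReal.toReal_add h1 h2]
    exact ⟨ne_top_of_le_ne_top h3 (h.le_osymmDiff_add a b),
      ENNReal.toReal_mono h3 (h.le_osymmDiff_add a b)⟩
  change Tendsto _ (comap _ _) extBasis.filter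
  refine extBasis.hasBasis.tendsto_right_iff.2 ?_
  rintro _ ⟨ε, hε, rfl⟩
  have ht := tendsto_const_mul_zero k (tendsto_comap (f := fun p : L × L =>
    η (osymmDiff p.1 p.2)) (x := 𝓝 0))
  filter_upwards [ht (Iio_mem_nhds (ENNReal.ofReal_pos.2 hε))]
  rintro ⟨a, b⟩ (hab : k * η (osymmDiff a b) < ENNReal.ofReal ε)
  have hfin : k * η (osymmDiff a b) ≠ ∞ := hab.ne_top
  have hreal : (k * η (osymmDiff a b)).toReal < ε := by
    rwa [← ENNReal.lt_ofReal_iff_toReal_lt hfin]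
  have hfin' : k * η (osymmDiff b a) ≠ ∞ := by rwa [osymmDiff_comm]
  by_cases hb : η b = ∞
  · have ha : η a = ∞ := by
      by_contra ha
      exact (hle hfin' ha).1 hb
    exact Or.inr (Prod.ext ha hb)
  · obtain ⟨ha, h1⟩ := hle hfin hb
    have h2 := (hle hfin' ha).2
    rw [osymmDiff_comm] at h2
    refine Or.inl ⟨ha, hb, ?_⟩
    dsimp only
    rw [abs_lt]
    constructor <;> linarith

end IsKSubmeasure

end SubmeasureUniformity

/-! ### D-uniformities and their neighbourhoods of zero -/

section DUniformity

/-- Uniform continuity of an operation on a subset of `L × L`, in terms of entourages of `L`. -/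
theorem exists_entourage_of_uniformContinuousOn {L : Type*} {U : UniformSpace L}
    {f : L × L → L} {s : Set (L × L)}
    (hf : UniformContinuousOn f s) {V : Set (L × L)} (hV : V ∈ 𝓤[U]) :
    ∃ W ∈ 𝓤[U], ∀ a b c d, (a, b) ∈ s → (c, d) ∈ s → (a, c) ∈ W → (b, d) ∈ W →
      (f (a, b), f (c, d)) ∈ V := by
  have h := hf hV
  rw [mem_map, mem_inf_principal, uniformity_prod_eq_comap_prod, mem_comap] at h
  obtain ⟨t, ht, hts⟩ := h
  obtain ⟨W, hW, hWt⟩ := mem_prod_same_iff.1 ht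
  exact ⟨W, hW, fun a b c d h1 h2 h3 h4 =>
    hts (show ((a, b), (c, d)) ∈ _ from hWt (Set.mk_mem_prod h3 h4)) ⟨h1, h2⟩⟩

variable {L : Type*} [DLattice L] {U : UniformSpace L}

namespace IsDUniformity

theorem exists_sup (hU : IsDUniformity U) {V : Set (L × L)} (hV : V ∈ 𝓤[U]) :
    ∃ W ∈ 𝓤[U], ∀ a b c d, (a, c) ∈ W → (b, d) ∈ W → (a ⊔ b, c ⊔ d) ∈ V := by
  simpa using exists_entourage_of_uniformContinuousOn
    (uniformContinuousOn_univ.2 hU.uniformContinuous_sup) hV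

theorem exists_inf (hU : IsDUniformity U) {V : Set (L × L)} (hV : V ∈ 𝓤[U]) :
    ∃ W ∈ 𝓤[U], ∀ a b c d, (a, c) ∈ W → (b, d) ∈ W → (a ⊓ b, c ⊓ d) ∈ V := by
  simpa using exists_entourage_of_uniformContinuousOn
    (uniformContinuousOn_univ.2 hU.uniformContinuous_inf) hV

theorem exists_osum (hU : IsDUniformity U) {V : Set (L × L)} (hV : V ∈ 𝓤[U]) :
    ∃ W ∈ 𝓤[U], ∀ a b c d, Orth a b → Orth c d → (a, c) ∈ W → (b, d) ∈ W →
      (osum a b, osum c d) ∈ V :=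
  exists_entourage_of_uniformContinuousOn hU.uniformContinuousOn_osum hV

theorem exists_odiff (hU : IsDUniformity U) {V : Set (L × L)} (hV : V ∈ 𝓤[U]) :
    ∃ W ∈ 𝓤[U], ∀ a b c d, b ≤ a → d ≤ c → (a, c) ∈ W → (b, d) ∈ W →
      (odiff a b, odiff c d) ∈ V :=
  exists_entourage_of_uniformContinuousOn hU.uniformContinuousOn_odiff hV

/-- The set of pairs `(a, b)` such that `a △ b` and all elements below it are `V`-close to `0`. -/
def _root_.DLattice.solidEntourage (V : Set (L × L)) : Set (L × L) :=
  {p | ∀ r ≤ osymmDiff p.1 p.2, ((0 : L), r) ∈ V}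

theorem solidEntourage_mem (hU : IsDUniformity U) {V : Set (L × L)} (hV : V ∈ 𝓤[U]) :
    solidEntourage V ∈ 𝓤[U] := by
  obtain ⟨V₁, hV₁, h₁⟩ := hU.exists_inf hV
  obtain ⟨V₂, hV₂, h₂⟩ := hU.exists_odiff hV₁
  obtain ⟨V₃, hV₃, h₃⟩ := hU.exists_sup hV₂
  obtain ⟨V₄, hV₄, h₄⟩ := hU.exists_inf hV₂
  obtain ⟨W, hW, hs, hWV⟩ := symm_of_uniformity (inter_mem hV₃ hV₄)
  filter_upwards [hW]
  rintro ⟨a, b⟩ hab r (hr : r ≤ odiff (a ⊔ b) (a ⊓ b))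
  have hba := hWV (SetRel.symm W hab)
  have hbb := hWV (show (b, b) ∈ W from refl_mem_uniformity hW)
  have hd := h₂ (b ⊔ b) (b ⊓ b) (a ⊔ b) (a ⊓ b) inf_le_sup inf_le_sup
    (h₃ _ _ _ _ hba.1 hbb.1) (h₄ _ _ _ _ hba.2 hbb.2)
  rw [sup_idem, inf_idem, odiff_self] at hd
  have := h₁ 0 r _ r hd (refl_mem_uniformity hV₁)
  rwa [inf_eq_left.2 (nonneg r), inf_eq_right.2 hr] at this

/-- A D-uniformity is determined by its neighbourhoods of `0`: if `a △ b` is close to `0`, then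
`a ∨ b = (a ∧ b) ⊕ (a △ b)` is close to `a ∧ b`; meeting with `a` and with `b` shows that both are
close to `a ∧ b`. -/
theorem exists_of_osymmDiff (hU : IsDUniformity U) {V : Set (L × L)} (hV : V ∈ 𝓤[U]) :
    ∃ W ∈ 𝓤[U], ∀ a b, ((0 : L), osymmDiff a b) ∈ W → (a, b) ∈ V := by
  obtain ⟨V₀, hV₀, hs, h₀⟩ := comp_symm_of_uniformity hV
  obtain ⟨V₁, hV₁, h₁⟩ := hU.exists_inf hV₀
  obtain ⟨V₂, hV₂, h₂⟩ := hU.exists_osum hV₁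
  refine ⟨V₂, hV₂, fun a b hab => ?_⟩
  have hle : a ⊓ b ≤ a ⊔ b := inf_le_sup
  have hsum := h₂ (a ⊓ b) 0 (a ⊓ b) (osymmDiff a b) ⟨_, oplus_zero _⟩ (orth_odiff hle)
    (refl_mem_uniformity hV₂) hab
  rw [osum_zero, osymmDiff, osum_odiff hle] at hsum
  have ha := h₁ _ a _ a hsum (refl_mem_uniformity hV₁)
  have hb := h₁ _ b _ b hsum (refl_mem_uniformity hV₁)
  rw [inf_eq_left.2 (inf_le_left : a ⊓ b ≤ a), inf_eq_right.2 (le_sup_left : a ≤ a ⊔ b)] at ha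
  rw [inf_eq_left.2 (inf_le_right : a ⊓ b ≤ b), inf_eq_right.2 (le_sup_right : b ≤ a ⊔ b)] at hb
  exact h₀ ⟨a ⊓ b, hs ha, hb⟩

end IsDUniformity

/-- A D-uniformity making `η` uniformly continuous has the sets `{η < ε}` among its neighbourhoods
of `0`, so it is finer than the uniformity of `η`. -/
theorem IsKSubmeasure.isUniformityOf {k : ℝ≥0} {η : L → ℝ≥0∞} (h : IsKSubmeasure k η) :
    IsUniformityOf η h.uniformity := by
  refine ⟨⟨h.isDUniformity_uniformity, h.uniformContinuous_uniformity⟩, ?_⟩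
  rintro W ⟨hW, hη⟩
  rw [h.le_uniformity_iff]
  refine ENNReal.nhds_zero_basis.tendsto_right_iff.2 fun ε hε => ?_
  obtain ⟨δ, hδ, hδε⟩ := ENNReal.lt_iff_exists_nnreal_btwn.1 hε
  have hδ' : (0 : ℝ) < δ := by exact_mod_cast hδ
  have hV : {p : L × L | (η p.1, η p.2) ∈ extEntourage δ} ∈ 𝓤[W] :=
    hη (extBasis.mem_filter_of_mem ⟨δ, hδ', rfl⟩)
  filter_upwards [hW.solidEntourage_mem hV] with p hp
  rcases hp _ le_rfl with ⟨-, h2, h3⟩ | h3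
  · simp only [h.zero, ENNReal.toReal_zero, zero_sub, abs_neg,
      abs_of_nonneg ENNReal.toReal_nonneg] at h3
    refine lt_trans ?_ hδε
    rw [← ENNReal.toReal_lt_toReal h2 ENNReal.coe_ne_top]
    exact h3
  · exact absurd (h.zero.symm.trans (Prod.mk.inj h3).1) ENNReal.zero_ne_top

/-- A D-uniformity is the supremum of the uniformities of `k`-submeasures as soon as each of its
entourages belongs to a coarser uniformity of this kind. -/
theorem exists_isSupOfUniformitiesOf {L : Type u} [DLattice L] {U : UniformSpace L} {k : ℝ≥0}
    (H : ∀ V ∈ 𝓤[U], ∃ (η : L → ℝ≥0∞) (h : IsKSubmeasure k η),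
      U ≤ h.uniformity ∧ V ∈ 𝓤[h.uniformity]) :
    ∃ (Λ : Type u) (η : Λ → L → ℝ≥0∞),
      (∀ l, IsKSubmeasure k (η l)) ∧ IsSupOfUniformitiesOf η U := by
  choose η h hle hmem using fun V : {V : Set (L × L) // V ∈ 𝓤[U]} => H V.1 V.2
  refine ⟨_, η, h, fun V => (h V).uniformity, fun V => (h V).isUniformityOf, ?_⟩
  refine le_antisymm (le_iInf hle) fun V hV => ?_
  have hle' : 𝓤[⨅ V, (h V).uniformity] ≤ 𝓤[(h ⟨V, hV⟩).uniformity] :=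
    iInf_le (fun V => (h V).uniformity) ⟨V, hV⟩
  exact hle' (hmem ⟨V, hV⟩)

end DUniformity

/-! ### Construction of submeasures from entourages -/

section Construction

variable {L : Type*} [DLattice L]

/-- The maps `x ↦ ((x ∨ b) ⊖ b) ∧ c` and `x ↦ ((x ∧ b') ⊕ b) ∧ c`: translations by `⊖ b` and
`⊕ b`, preceded by the truncation that makes them everywhere defined and followed by a truncation
at `c`. -/
def IsTruncatedTranslation (f : L → L) : Prop :=
  ∃ b c, (f = fun x => odiff (x ⊔ b) b ⊓ c) ∨ f = fun x => osum (x ⊓ ocompl b) b ⊓ c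

/-- If truncated translations have Lipschitz constant `k` for a distance `ρ`, then
`a ↦ sup {ρ 0 c | c ≤ a}` is a `k`-submeasure: each defining inequality is obtained by moving the
pair `(0, a)` with a truncated translation. The supremum makes the function monotone at no cost
in the constant. -/
theorem exists_isKSubmeasure_of_dist {ρ : L → L → ℝ≥0} {k : ℝ≥0} (h0 : ∀ x, ρ x x = 0)
    (htri : ∀ x y z, ρ x z ≤ ρ x y + ρ y z)
    (hρ : ∀ f : L → L, IsTruncatedTranslation f → ∀ x y, ρ (f x) (f y) ≤ k * ρ x y) :
    ∃ η : L → ℝ≥0∞, IsKSubmeasure k η ∧ ∀ a, ρ 0 a ≤ η a ∧ η a ≤ k * ρ 0 a := by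
  have hle : ∀ a c : L, c ≤ a → (ρ 0 c : ℝ≥0∞) ≤ ⨆ c ≤ a, (ρ 0 c : ℝ≥0∞) := fun a c h =>
    le_iSup₂_of_le c h le_rfl
  have hsub : ∀ a b c : L, c ≤ odiff (a ⊔ b) b → ρ 0 c ≤ k * ρ 0 a := by
    intro a b c hc
    have := hρ _ ⟨b, c, Or.inl rfl⟩ 0 a
    rwa [sup_eq_right.2 (nonneg b), odiff_self, inf_eq_left.2 (nonneg c), inf_eq_right.2 hc]
      at this
  refine ⟨fun a => ⨆ c ≤ a, (ρ 0 c : ℝ≥0∞), ⟨?_, ?_, ?_, ?_⟩, fun a => ⟨hle a a le_rfl, ?_⟩⟩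
  · refine le_antisymm (iSup₂_le fun c hc => ?_) zero_le
    rw [eq_zero_of_le_zero hc, h0, ENNReal.coe_zero]
  · exact fun a b hab => iSup₂_le fun c hc => hle b c (hc.trans hab)
  · intro a b hab
    refine iSup₂_le fun c hc => ?_
    have hshift := hρ _ ⟨b, c, Or.inr rfl⟩ 0 a
    rw [inf_eq_left.2 (nonneg _), zero_osum, inf_eq_left.2 (orth_iff.1 hab), inf_eq_right.2 hc]
      at hshift
    calc (ρ 0 c : ℝ≥0∞) ≤ ((ρ 0 (b ⊓ c) + k * ρ 0 a : ℝ≥0) : ℝ≥0∞) := by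
          exact_mod_cast (htri 0 (b ⊓ c) c).trans (add_le_add le_rfl hshift)
      _ = k * ρ 0 a + ρ 0 (b ⊓ c) := by push_cast; rw [add_comm]
      _ ≤ _ := by
          gcongr
          · exact hle a a le_rfl
          · exact hle b _ inf_le_left
  · intro a b
    refine iSup₂_le fun c hc => ?_
    calc (ρ 0 c : ℝ≥0∞) ≤ k * ρ 0 a := by exact_mod_cast hsub a b c hc
      _ ≤ _ := by gcongr; exact hle a a le_rfl
  · refine iSup₂_le fun c hc => ?_
    have hc' : c ≤ odiff (a ⊔ 0) 0 := by rwa [odiff_zero, sup_eq_left.2 (nonneg a)]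
    exact_mod_cast hsub a 0 c hc'

theorem IsMV.osymmDiff_truncatedTranslation_le (h : IsMV L) {f : L → L}
    (hf : IsTruncatedTranslation f) (x y : L) : osymmDiff (f x) (f y) ≤ osymmDiff x y := by
  obtain ⟨b, c, rfl | rfl⟩ := hf
  · exact ((h.osymmDiff_inf_le _ _ c).trans (osymmDiff_odiff_le le_sup_right le_sup_right)).trans
      (h.osymmDiff_sup_le x y b)
  · exact ((h.osymmDiff_inf_le _ _ c).trans
      (osymmDiff_osum_le (orth_iff.2 inf_le_right) (orth_iff.2 inf_le_right))).trans
      (h.osymmDiff_inf_le x y _)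

variable {U : UniformSpace L}

/-- Truncated translations are uniformly equicontinuous. -/
theorem IsDUniformity.exists_truncatedTranslation (hU : IsDUniformity U) {V : Set (L × L)}
    (hV : V ∈ 𝓤[U]) :
    ∃ W ∈ 𝓤[U], ∀ f : L → L, IsTruncatedTranslation f → ∀ x y, (x, y) ∈ W →
      (f x, f y) ∈ V := by
  obtain ⟨V₁, hV₁, h₁⟩ := hU.exists_inf hV
  obtain ⟨V₂, hV₂, h₂⟩ := hU.exists_odiff hV₁
  obtain ⟨V₃, hV₃, h₃⟩ := hU.exists_sup hV₂
  obtain ⟨V₄, hV₄, h₄⟩ := hU.exists_osum hV₁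
  obtain ⟨V₅, hV₅, h₅⟩ := hU.exists_inf hV₄
  refine ⟨V₃ ∩ V₅, inter_mem hV₃ hV₅, ?_⟩
  rintro f ⟨b, c, rfl | rfl⟩ x y ⟨hxy, hxy'⟩
  · exact h₁ _ _ _ _ (h₂ _ _ _ _ le_sup_right le_sup_right
      (h₃ _ _ _ _ hxy (refl_mem_uniformity hV₃)) (refl_mem_uniformity hV₂))
      (refl_mem_uniformity hV₁)
  · exact h₁ _ _ _ _ (h₄ _ _ _ _ (orth_iff.2 inf_le_right) (orth_iff.2 inf_le_right)
      (h₅ _ _ _ _ hxy' (refl_mem_uniformity hV₅)) (refl_mem_uniformity hV₄))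
      (refl_mem_uniformity hV₁)

theorem tendsto_zero_of_eventually_le_pow {α : Type*} {l : Filter α} {f : α → ℝ≥0∞} {k q : ℝ≥0}
    (hq : q < 1) (h : ∀ n : ℕ, ∀ᶠ x in l, f x ≤ k * (q ^ n : ℝ≥0)) : Tendsto f l (𝓝 0) := by
  refine ENNReal.nhds_zero_basis.tendsto_right_iff.2 fun ε hε => ?_
  have hpow : Tendsto (fun n : ℕ => ((q ^ n : ℝ≥0) : ℝ≥0∞)) atTop (𝓝 0) := by
    rw [← ENNReal.coe_zero, ENNReal.tendsto_coe]
    exact NNReal.tendsto_pow_atTop_nhds_zero_of_lt_one hq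
  obtain ⟨n, hn⟩ := ((tendsto_const_mul_zero k hpow).eventually (Iio_mem_nhds hε)).exists
  exact (h n).mono fun x hx => hx.trans_lt hn

/-- From a suitable sequence of entourages to a `k`-submeasure. Truncated translations may lose
one index of the sequence if the ratio `q` of radii satisfies `q⁻¹ ≤ k`, and none if `k = 1`. -/
theorem IsDUniformity.exists_isKSubmeasure_of_seq (hU : IsDUniformity U) {k q : ℝ≥0}
    (hq : 2⁻¹ ≤ q) (h1 : q < 1) {V W : ℕ → Set (L × L)} (hV : ∀ n, V n ∈ 𝓤[U])
    (hs : ∀ n x y, (x, y) ∈ V n → (y, x) ∈ V n)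
    (ht : ∀ n x y z w, (x, y) ∈ V (n + 1) → (y, z) ∈ V (n + 1) → (z, w) ∈ V (n + 1) →
      (x, w) ∈ V n)
    (hf : (q⁻¹ ≤ k ∧ ∀ f : L → L, IsTruncatedTranslation f →
        ∀ n x y, (x, y) ∈ V (n + 1) → (f x, f y) ∈ V n) ∨
      (1 ≤ k ∧ ∀ f : L → L, IsTruncatedTranslation f →
        ∀ n x y, (x, y) ∈ V n → (f x, f y) ∈ V n))
    (hVW : ∀ n, ∃ m, ∀ a b, ((0 : L), osymmDiff a b) ∈ V m → (a, b) ∈ W n) :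
    ∃ (η : L → ℝ≥0∞) (h : IsKSubmeasure k η),
      U ≤ h.uniformity ∧ ∀ n, W n ∈ 𝓤[h.uniformity] := by
  obtain ⟨ρ, hρ0, htri, hle, hge, hmap, hmap'⟩ :=
    exists_chainDist hq h1 (fun n x => refl_mem_uniformity (hV n)) hs ht
  have hρ : ∀ f : L → L, IsTruncatedTranslation f → ∀ x y, ρ (f x) (f y) ≤ k * ρ x y := by
    intro f htt x y
    rcases hf with ⟨hk, hf⟩ | ⟨hk, hf⟩
    · exact (hmap f (hf f htt) x y).trans (mul_le_mul_left hk _)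
    · exact (hmap' f (hf f htt) x y).trans (le_mul_of_one_le_left zero_le hk)
  obtain ⟨η, hη, hηρ⟩ := exists_isKSubmeasure_of_dist hρ0 htri hρ
  refine ⟨η, hη, hη.le_uniformity_iff.2 ?_, fun n => ?_⟩
  · refine tendsto_zero_of_eventually_le_pow (k := k) h1 fun n => ?_
    filter_upwards [hU.solidEntourage_mem (hV n)] with p hp
    refine (hηρ _).2.trans ?_
    gcongr
    exact hle n _ _ (hp _ le_rfl)
  · obtain ⟨m, hm⟩ := hVW n
    have hq0 : 0 < q := lt_of_lt_of_le (by positivity) hq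
    have hε : (0 : ℝ≥0∞) < ((q ^ m / 2 : ℝ≥0) : ℝ≥0∞) :=
      ENNReal.coe_pos.2 (div_pos (pow_pos hq0 m) two_pos)
    rw [hη.uniformity_eq]
    refine mem_of_superset (preimage_mem_comap (Iio_mem_nhds hε)) ?_
    rintro ⟨a, b⟩ hab
    have hlt : ρ 0 (osymmDiff a b) < q ^ m / 2 := by
      exact_mod_cast (hηρ _).1.trans_lt hab
    refine hm a b (hge m _ _ ?_)
    rwa [lt_div_iff₀ two_pos, mul_comm] at hlt

/-- For `k > 1`, countably many entourages of a D-uniformity are captured by a single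
`k`-submeasure. Passing from one entourage of the chosen sequence to the next absorbs the
application of a truncated translation, at the price of a factor `q⁻¹ ≤ k`. -/
theorem IsDUniformity.exists_isKSubmeasure (hU : IsDUniformity U) {k : ℝ≥0} (hk : 1 < k)
    {W : ℕ → Set (L × L)} (hW : ∀ n, W n ∈ 𝓤[U]) :
    ∃ (η : L → ℝ≥0∞) (h : IsKSubmeasure k η),
      U ≤ h.uniformity ∧ ∀ n, W n ∈ 𝓤[h.uniformity] := by
  obtain ⟨V, hV⟩ := exists_seq_of_step (α := Set (L × L))
    (P := fun S => S ∈ 𝓤[U] ∧ ∀ x y, (x, y) ∈ S → (y, x) ∈ S)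
    (R := fun n S T => (∀ x y z w, (x, y) ∈ T → (y, z) ∈ T → (z, w) ∈ T → (x, w) ∈ S) ∧
      (∀ f : L → L, IsTruncatedTranslation f → ∀ x y, (x, y) ∈ T → (f x, f y) ∈ S) ∧
      ∀ a b, ((0 : L), osymmDiff a b) ∈ T → (a, b) ∈ W n)
    ⟨Set.univ, univ_mem, fun _ _ _ => trivial⟩ (by
      rintro n S ⟨hS, -⟩
      obtain ⟨S₁, hS₁, h₁⟩ := comp_mem_uniformity_sets hS
      obtain ⟨S₂, hS₂, h₂⟩ := comp_mem_uniformity_sets hS₁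
      obtain ⟨S₃, hS₃, h₃⟩ := hU.exists_truncatedTranslation hS
      obtain ⟨S₄, hS₄, h₄⟩ := hU.exists_of_osymmDiff (hW n)
      obtain ⟨T, hT, hTs, hTsub⟩ := symm_of_uniformity
        (inter_mem (inter_mem hS₁ hS₂) (inter_mem hS₃ hS₄))
      refine ⟨T, ⟨hT, fun x y hxy => SetRel.symm T hxy⟩, fun x y z w hxy hyz hzw => ?_,
        fun f hf x y hxy => h₃ f hf x y (hTsub hxy).2.1, fun a b hab => h₄ a b (hTsub hab).2.2⟩
      exact h₁ ⟨z, h₂ ⟨y, (hTsub hxy).1.2, (hTsub hyz).1.2⟩, (hTsub hzw).1.1⟩)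
  have hk0 : 0 < k := one_pos.trans hk
  -- `q⁻¹ = min k 2`: the chain distance needs `q ≥ 1 / 2`, the Lipschitz bound needs `q⁻¹ ≤ k`.
  exact hU.exists_isKSubmeasure_of_seq (q := max k⁻¹ 2⁻¹) (le_max_right _ _)
    (max_lt (inv_lt_one_of_one_lt₀ hk) (inv_lt_one_of_one_lt₀ one_lt_two))
    (fun n => (hV n).1.1) (fun n => (hV n).1.2) (fun n => (hV n).2.1)
    (Or.inl ⟨inv_le_of_inv_le₀ hk0 (le_max_left _ _), fun f hf n => (hV n).2.2.1 f hf⟩)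
    (fun n => ⟨n + 1, (hV n).2.2.2⟩)

/-- In an MV-algebra truncated translations do not increase symmetric differences, hence they
preserve the entourages `solidEntourage S`. -/
theorem IsDUniformity.exists_isKSubmeasure_one_of_isMV (hU : IsDUniformity U) (hL : IsMV L)
    {W : Set (L × L)} (hW : W ∈ 𝓤[U]) :
    ∃ (η : L → ℝ≥0∞) (h : IsKSubmeasure 1 η), U ≤ h.uniformity ∧ W ∈ 𝓤[h.uniformity] := by
  obtain ⟨V, hV⟩ := exists_seq_of_step (α := Set (L × L))
    (P := fun S => ∃ S' ∈ 𝓤[U], S = solidEntourage S')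
    (R := fun _ S T => (∀ x y z w, (x, y) ∈ T → (y, z) ∈ T → (z, w) ∈ T → (x, w) ∈ S) ∧
      ∀ a b, ((0 : L), osymmDiff a b) ∈ T → (a, b) ∈ W)
    ⟨_, Set.univ, univ_mem, rfl⟩ (by
      rintro n S ⟨S', hS', rfl⟩
      obtain ⟨S₁, hS₁, h₁⟩ := comp_mem_uniformity_sets (hU.solidEntourage_mem hS')
      obtain ⟨S₂, hS₂, h₂⟩ := comp_mem_uniformity_sets hS₁
      obtain ⟨S₃, hS₃, h₃⟩ := hU.exists_of_osymmDiff (inter_mem hS₁ hS₂)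
      obtain ⟨S₄, hS₄, h₄⟩ := hU.exists_of_osymmDiff hW
      have hT : ∀ {x y}, (x, y) ∈ solidEntourage (S₃ ∩ S₄) → (x, y) ∈ S₁ ∩ S₂ :=
        fun {x y} hxy => h₃ x y (hxy _ le_rfl).1
      refine ⟨_, ⟨S₃ ∩ S₄, inter_mem hS₃ hS₄, rfl⟩, fun x y z w hxy hyz hzw =>
        h₁ ⟨z, h₂ ⟨y, (hT hxy).2, (hT hyz).2⟩, (hT hzw).1⟩, fun a b hab => h₄ a b ?_⟩
      exact (hab _ (zero_osymmDiff _).ge).2)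
  have hsolid : ∀ n x y x' y', osymmDiff x' y' ≤ osymmDiff x y → (x, y) ∈ V n →
      (x', y') ∈ V n := by
    intro n x y x' y' hle
    obtain ⟨S, -, hS⟩ := (hV n).1
    rw [hS]
    exact fun hxy r hr => hxy r (hr.trans hle)
  obtain ⟨η, h, hle, hmem⟩ := hU.exists_isKSubmeasure_of_seq (q := 2⁻¹) (k := 1)
    (W := fun _ => W) le_rfl (inv_lt_one_of_one_lt₀ one_lt_two)
    (fun n => by
      obtain ⟨S, hS, hVS⟩ := (hV n).1
      exact hVS ▸ hU.solidEntourage_mem hS)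
    (fun n x y => hsolid n x y y x (osymmDiff_comm _ _).le) (fun n => (hV n).2.1)
    (Or.inr ⟨le_rfl, fun f hf n x y => hsolid n _ _ _ _
      (hL.osymmDiff_truncatedTranslation_le hf x y)⟩)
    (fun n => ⟨n + 1, (hV n).2.2⟩)
  exact ⟨η, h, hle, hmem 0⟩

end Construction

/-! ### Submeasures from modular measures -/

section ModularMeasure

/-- Every neighbourhood of `0` in a topological abelian group contains a ball of a continuous
subadditive function vanishing at `0`. -/
theorem exists_subadditive_of_mem_nhds_zero {G : Type*} [AddCommGroup G] [TopologicalSpace G]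
    [IsTopologicalAddGroup G] {N : Set G} (hN : N ∈ 𝓝 (0 : G)) :
    ∃ p : G → ℝ≥0, p 0 = 0 ∧ (∀ x y, p (x + y) ≤ p x + p y) ∧
      Tendsto (fun x => (p x : ℝ≥0∞)) (𝓝 0) (𝓝 0) ∧ ∃ ε > 0, ∀ x, p x < ε → x ∈ N := by
  obtain ⟨S, hS⟩ := exists_seq_of_step (α := Set G)
    (P := fun S => S ∈ 𝓝 (0 : G) ∧ ∀ x ∈ S, -x ∈ S)
    (R := fun _ S T => (∀ x ∈ T, ∀ y ∈ T, ∀ z ∈ T, x + y + z ∈ S) ∧ T ⊆ N)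
    ⟨Set.univ, univ_mem, fun _ _ => trivial⟩ (by
      rintro - S ⟨hS, -⟩
      obtain ⟨T, hT, hTS⟩ := exists_nhds_zero_quarter hS
      have hT' : T ∩ N ∈ 𝓝 (0 : G) := inter_mem hT hN
      refine ⟨(T ∩ N) ∩ -(T ∩ N), ⟨inter_mem hT' (neg_mem_nhds_zero G hT'), ?_⟩, ?_,
        fun x hx => hx.1.2⟩
      · rintro x ⟨hx, hx'⟩
        exact ⟨hx', by simpa using hx⟩
      · intro x hx y hy z hz
        simpa using hTS hx.1.1 hy.1.1 hz.1.1 (mem_of_mem_nhds hT))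
  have hq : (2⁻¹ : ℝ≥0) < 1 := inv_lt_one_of_one_lt₀ one_lt_two
  obtain ⟨ρ, hρ0, htri, hle, hge, -, hmap⟩ :=
    exists_chainDist (X := G) (V := fun n => {p | p.2 - p.1 ∈ S n}) (q := 2⁻¹) le_rfl hq
      (fun n x => by simpa using mem_of_mem_nhds (hS n).1.1)
      (fun n x y hxy => by simpa using (hS n).1.2 _ hxy)
      (fun n x y z w hxy hyz hzw => by
        have := (hS n).2.1 _ hxy _ hyz _ hzw
        simpa using this)
  -- `S 1 ⊆ N` is the first inclusion in `N` provided by the choice of the sequence, whence the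
  -- exponent of the radius.
  refine ⟨fun x => ρ 0 x, hρ0 0, fun x y => ?_, ?_, 2⁻¹ ^ 1 / 2, by positivity, fun x hx => ?_⟩
  · have := hmap (fun z => x + z) (fun n a b hab => by simpa using hab) 0 y
    rw [add_zero] at this
    exact (htri 0 x (x + y)).trans (add_le_add le_rfl this)
  · refine tendsto_zero_of_eventually_le_pow (k := 1) hq fun n => ?_
    filter_upwards [(hS n).1.1] with x hx
    rw [ENNReal.coe_one, one_mul]
    exact_mod_cast hle n 0 x (by simpa using hx)
  · refine (hS 0).2.2 ?_
    rw [lt_div_iff₀ two_pos, mul_comm] at hx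
    simpa using hge 1 0 x hx

variable {L : Type*} [DLattice L] {G : Type*} [AddCommGroup G]

theorem IsModularMeasure.map_odiff {μ : L → G} (hμ : IsModularMeasure μ) {a b : L} (h : a ≤ b) :
    μ (odiff b a) = μ b - μ a := by
  have := hμ.additive a _ (orth_odiff h)
  rw [osum_odiff h] at this
  rw [this, add_sub_cancel_left]

/-- The variation of a modular measure with respect to a subadditive function is a submeasure:
by modularity, `μ` takes no values below `(a ∨ b) ⊖ b` which it does not take below `a`. -/
theorem IsModularMeasure.isKSubmeasure_iSup {μ : L → G} (hμ : IsModularMeasure μ) {p : G → ℝ≥0}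
    (hp0 : p 0 = 0) (hp : ∀ x y, p (x + y) ≤ p x + p y) :
    IsKSubmeasure 1 fun a : L => ⨆ r ≤ a, (p (μ r) : ℝ≥0∞) := by
  have hle : ∀ a r : L, r ≤ a → (p (μ r) : ℝ≥0∞) ≤ ⨆ r ≤ a, (p (μ r) : ℝ≥0∞) := fun a r h =>
    le_iSup₂_of_le r h le_rfl
  have hμ0 : μ 0 = 0 := by
    simpa [odiff_self] using hμ.map_odiff (le_refl (0 : L))
  refine ⟨?_, ?_, ?_, ?_⟩
  · refine le_antisymm (iSup₂_le fun r hr => ?_) zero_le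
    rw [eq_zero_of_le_zero hr, hμ0, hp0, ENNReal.coe_zero]
  · exact fun a b hab => iSup₂_le fun r hr => hle b r (hr.trans hab)
  · intro a b hab
    refine iSup₂_le fun r hr => ?_
    -- Split `r` into `r ∧ b` and a remainder on which `μ` agrees with its value at
    -- `(r ∨ b) ⊖ b ≤ a`.
    have hrb : r ⊔ b ≤ osum a b := sup_le hr (le_of_oplus_right (oplus_osum hab))
    have h1 : odiff (r ⊔ b) b ≤ a :=
      (odiff_le_odiff_right le_sup_right hrb).trans_eq (odiff_osum_right hab)
    have h2 : μ r = μ (odiff (r ⊔ b) b) + μ (r ⊓ b) := by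
      rw [hμ.map_odiff le_sup_right, eq_comm, sub_add_eq_add_sub, ← hμ.modular,
        add_sub_cancel_right]
    calc (p (μ r) : ℝ≥0∞) ≤ p (μ (odiff (r ⊔ b) b)) + p (μ (r ⊓ b)) := by
          rw [h2]; exact_mod_cast hp _ _
      _ ≤ _ := by
          rw [ENNReal.coe_one, one_mul]
          exact add_le_add (hle a _ h1) (hle b _ inf_le_right)
  · intro a b
    rw [ENNReal.coe_one, one_mul]
    refine iSup₂_le fun r hr => ?_
    -- With `s = b ⊕ r`, so that `b ≤ s ≤ a ∨ b`, one has `μ r = μ ((a ∧ s) ⊖ (a ∧ b))`.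
    obtain ⟨s, hs, -⟩ := EffectAlgebra.oplus_assoc _ _ _ _ _ (oplus_odiff hr)
      (oplus_odiff (le_sup_right : b ≤ a ⊔ b))
    have hbs := le_of_oplus_left hs
    have hsr := odiff_eq_of_oplus hs
    have hsab : s ≤ a ⊔ b := le_of_odiff_le_odiff hbs le_sup_right (hsr.trans_le hr)
    have hsup : a ⊔ s = a ⊔ b :=
      le_antisymm (sup_le le_sup_left hsab) (sup_le_sup_left hbs a)
    have hinf : a ⊓ b ≤ a ⊓ s := inf_le_inf_left a hbs
    have hμr : μ r = μ (odiff (a ⊓ s) (a ⊓ b)) := by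
      rw [← hsr, hμ.map_odiff hbs, hμ.map_odiff hinf]
      have e1 := hμ.modular a s
      have e2 := hμ.modular a b
      rw [hsup] at e1
      have e3 : μ s = μ (a ⊔ b) + μ (a ⊓ s) - μ a := by rw [← e1]; abel
      have e4 : μ b = μ (a ⊔ b) + μ (a ⊓ b) - μ a := by rw [← e2]; abel
      rw [e3, e4]; abel
    rw [hμr]
    exact hle a _ ((odiff_le hinf).trans inf_le_left)

/-- The sets `{(a, b) | ∀ r ≤ a △ b, p (μ r) < ε}`, which form a base of the uniformity of the
variation of `μ`, are compared directly with the given base of `U`. -/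
theorem IsModularMeasure.exists_isKSubmeasure_one [TopologicalSpace G] [IsTopologicalAddGroup G]
    {μ : L → G} (hμ : IsModularMeasure μ) {U : UniformSpace L} (hgen : IsGeneratedBy μ U)
    {W : Set (L × L)} (hW : W ∈ 𝓤[U]) :
    ∃ (η : L → ℝ≥0∞) (h : IsKSubmeasure 1 η), U ≤ h.uniformity ∧ W ∈ 𝓤[h.uniformity] := by
  obtain ⟨N, hN, hNW⟩ := hgen.mem_iff.1 hW
  obtain ⟨p, hp0, hp, htend, ε, hε, hpN⟩ := exists_subadditive_of_mem_nhds_zero hN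
  have h := hμ.isKSubmeasure_iSup hp0 hp
  refine ⟨_, h, h.le_uniformity_iff.2 ?_, ?_⟩
  · refine ENNReal.nhds_zero_basis_Iic.tendsto_right_iff.2 fun δ hδ => ?_
    filter_upwards [hgen.mem_of_mem (htend (Iic_mem_nhds hδ))] with x hx
    have hle : (⨆ r ≤ osymmDiff x.1 x.2, (p (μ r) : ℝ≥0∞)) ≤ δ :=
      iSup₂_le fun r hr => by exact hx r hr
    exact hle
  · rw [h.uniformity_eq]
    refine mem_of_superset (preimage_mem_comap (Iio_mem_nhds (ENNReal.coe_pos.2 hε))) ?_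
    rintro ⟨a, b⟩ hab
    refine hNW fun r hr => hpN _ ?_
    have hr' : (p (μ r) : ℝ≥0∞) ≤ ⨆ r ≤ osymmDiff a b, (p (μ r) : ℝ≥0∞) :=
      le_iSup₂_of_le r hr le_rfl
    exact_mod_cast hr'.trans_lt hab

end ModularMeasure
end DLattice

/-! ### D-uniformities as suprema of uniformities of submeasures -/

theorem mainTheorem3 {L : Type u} [DLattice L] (U : UniformSpace L)
    (hU : DLattice.IsDUniformity U) :
    (∀ k : ℝ≥0, 1 < k →
      (∃ (Λ : Type u) (η : Λ → L → ℝ≥0∞),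
        (∀ l, DLattice.IsKSubmeasure k (η l)) ∧ DLattice.IsSupOfUniformitiesOf η U) ∧
      ((𝓤[U]).IsCountablyGenerated →
        ∃ η : L → ℝ≥0∞, DLattice.IsKSubmeasure k η ∧ DLattice.IsUniformityOf η U)) ∧
    (∀ (G : Type v) [AddCommGroup G] [TopologicalSpace G] [IsTopologicalAddGroup G]
      (μ : L → G), DLattice.IsModularMeasure μ → DLattice.IsGeneratedBy μ U →
      ∃ (Λ : Type u) (η : Λ → L → ℝ≥0∞),
        (∀ l, DLattice.IsKSubmeasure 1 (η l)) ∧ DLattice.IsSupOfUniformitiesOf η U) ∧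
    (DLattice.IsMV L →
      ∃ (Λ : Type u) (η : Λ → L → ℝ≥0∞),
        (∀ l, DLattice.IsKSubmeasure 1 (η l)) ∧ DLattice.IsSupOfUniformitiesOf η U) := by
  refine ⟨fun k hk => ⟨?_, fun hc => ?_⟩, fun G _ _ _ μ hμ hgen => ?_, fun hL => ?_⟩
  · refine DLattice.exists_isSupOfUniformitiesOf fun V hV => ?_
    obtain ⟨η, h, hle, hmem⟩ := hU.exists_isKSubmeasure hk (W := fun _ => V) fun _ => hV
    exact ⟨η, h, hle, hmem 0⟩
  · obtain ⟨W, hW⟩ := (𝓤[U]).exists_antitone_basis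
    obtain ⟨η, h, hle, hmem⟩ := hU.exists_isKSubmeasure hk hW.mem
    have hge : h.uniformity ≤ U := fun V hV => by
      obtain ⟨n, hn⟩ := hW.mem_iff.1 hV
      exact mem_of_superset (hmem n) hn
    exact ⟨η, h, le_antisymm hge hle ▸ h.isUniformityOf⟩
  · exact DLattice.exists_isSupOfUniformitiesOf fun V hV =>
      hμ.exists_isKSubmeasure_one hgen hV
  · exact DLattice.exists_isSupOfUniformitiesOf fun V hV =>
      hU.exists_isKSubmeasure_one_of_isMV hL hV
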